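/- **Model.** Let $G=(V,E)$ be a finite digraph with $m=|E|$ edges. In a $T$-round synchronous protocol $\pi$ on $G$, each party $p\in V$ holds an input $x_p$ (which may include her private random string); in each of the $T$ rounds she sends one bit on each outgoing edge, determined by $x_p$ and by the bits that she received in the earlier rounds, and at the end she gives an output determined by $x_p$ and by the bits that she received. An adversary, who knows all inputs and the whole history of communications, may flip transmitted bits. A protocol $\sigma$ on $G$ with $T'$ rounds *simulates $\pi$ and tolerates the bit error rate $\rho$* if, for all inputs and all adversaries, whenever at most a fraction $\rho$ of the $T'm$ bits transmitted in the execution of $\sigma$ are flipped, every party gives the output that she gives in the noiseless execution of $\pi$ on the same inputs. A *ternary tree code* of infinite depth with distance parameter $\frac12$ and alphabet $S$ assigns to each nonempty word $y$ over $\{0,1,\mathrm{bkp}\}$ a character $\lambda(y)\in S$, such that for all words $p,u,v$ with $|u|=|v|$ and all symbols $a\ne b$, the sequences of characters assigned to the nonempty prefixes of $pau$ and of $pbv$ differ in at least $\frac12(|u|+1)$ positions. The characters of an alphabet of size $287$ are represented, through a fixed injection, by blocks of $9$ bits. **The (modified) Rajagopalan–Schulman compiler.** Given $\pi$, each party $p$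 with $T$-round instructions is first given, for each incoming edge $(q,p)$, a dummy outgoing edge; in round $t+1$ she sends on it the bit received on $(q,p)$ in round $t$ (and $0$ in round $1$). The resulting protocol $\bar\pi$ has $T+1$ rounds; in round $T+1$ ordinary edges carry $0$, and afterwards all edges carry $0$. The simulation $\mathrm{RS}(\pi)$ runs on $G$ for $2T+1$ steps of $9$ rounds. In each step, every party * decodes, for each incoming edge, the blocks received in the previous steps to a word over $\{0,1,\mathrm{bkp}\}$ whose encoding is nearest in Hamming distance (counted in characters), and parses it from left to right, where $\mathrm{bkp}$ deletes the preceding symbol; * parses in the same way the words she has herself sent on her outgoing edges (dummy edges included), obtaining outgoing transcripts of some common length $L$; * checks whether all her estimated incoming transcripts have length at least $L$ and, for each $t\le L$, the $t$-th outgoing bits are those that $\bar\pi$ specifies given the length-$(t-1)$ prefixes of the incoming transcripts. If so, the next symbols are the bits that $\bar\pi$ specifies given the length-$L$ prefixes; otherwise the next symbol is $\mathrm{bkp}$ on all outgoing edges; * sends on each ordinary outgoing edge the $9$-bit block of the tree code character of the word of all symbols sent on it so far, the new one included. (Nothing is physically sent on dummy edges.) At the end each party reads off the dummy edges of her parsed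 outgoing transcript, in rounds $2,\dots,T+1$, the bits she would have received in $\pi$, and gives the output that $\pi$ prescribes for them. **Proposition.** A ternary tree code of infinite depth with distance parameter $\frac12$ and alphabet size $287$ exists. For each such tree code and each representation of its characters by $9$-bit blocks, the compiler $\mathrm{RS}$ has the following property: for every finite digraph $G$ with $m$ edges and every $T$-round protocol $\pi$ on $G$, the protocol $\mathrm{RS}(\pi)$ on $G$ has round complexity at most $27T$ (if $T\ge 1$), and it simulates $\pi$ and tolerates the bit error rate $\frac{1}{1296\,m}$. -/

import Mathlib

universe u v w

/-! ## Synchronous protocols on digraphs, and adversarial channel noise -/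

section Protocols

variable {V : Type u}

/-- The directed edges of `G`. -/
abbrev DEdge (G : Digraph V) : Type u := {p : V × V // G.Adj p.1 p.2}

/-- The in-neighbours of `p`, that is, the edges on which `p` receives. -/
abbrev InNbr (G : Digraph V) (p : V) : Type u := {q : V // G.Adj q p}

/-- The out-neighbours of `p`, that is, the edges on which `p` transmits. -/
abbrev OutNbr (G : Digraph V) (p : V) : Type u := {q : V // G.Adj p q}

/-- A synchronous protocol on the digraph `G`, in which party `p` starts with `x p : X p`
(her input, together with her private random string if the protocol is randomized) and ends
with an output in `Y p`. In every one of the `rounds` rounds each party sends one bit to each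
of her out-neighbours; the bit depends on her input and on the bits that she has received in
the previous rounds (a list with one entry per elapsed round, oldest first). -/
structure Protocol (G : Digraph V) (X : V → Type v) (Y : V → Type w) where
  rounds : ℕ
  send : ∀ p : V, X p → List (InNbr G p → Bool) → OutNbr G p → Bool
  output : ∀ p : V, X p → List (InNbr G p → Bool) → Y p

/-- What happens on the channels in one round: the bits sent and the bits received. -/
structure RoundRecord (G : Digraph V) where
  sent : DEdge G → Bool
  received : DEdge G → Bool

/-- An adaptive adversary: knowing all inputs, the whole history of communications and the bits
that are being sent in the present round, she decides which bits are received. -/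
abbrev Adversary (G : Digraph V) (X : V → Type v) : Type (max u v) :=
  (∀ p, X p) → List (RoundRecord G) → (DEdge G → Bool) → DEdge G → Bool

/-- The adversary that never changes a bit, that is, a noiseless network. -/
def Adversary.noiseless (G : Digraph V) (X : V → Type v) : Adversary G X :=
  fun _ _ s => s

/-- The bits received by party `p` according to a channel history. -/
def receivedBy {G : Digraph V} (H : List (RoundRecord G)) (p : V) :
    List (InNbr G p → Bool) :=
  H.map fun r q => r.received ⟨(q.1, p), q.2⟩

namespace Protocol

variable {G : Digraph V} {X : V → Type v} {Y : V → Type w}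

/-- The channel history of the first `t` rounds of an execution. -/
def history (π : Protocol G X Y) (A : Adversary G X) (x : ∀ p, X p) :
    ℕ → List (RoundRecord G)
  | 0 => []
  | t + 1 =>
    let H := history π A x t
    let s : DEdge G → Bool := fun e =>
      π.send e.1.1 (x e.1.1) (receivedBy H e.1.1) ⟨e.1.2, e.2⟩
    H ++ [⟨s, A x H s⟩]

/-- The output of party `p` in an execution. -/
def result (π : Protocol G X Y) (A : Adversary G X) (x : ∀ p, X p) (p : V) : Y p :=
  π.output p (x p) (receivedBy (π.history A x π.rounds) p)

/-- The number of bit errors in an execution: over all rounds and all edges, the number of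
transmitted bits that arrive flipped. -/
def bitErrors [Fintype V] [DecidableRel G.Adj]
    (π : Protocol G X Y) (A : Adversary G X) (x : ∀ p, X p) : ℕ :=
  ((π.history A x π.rounds).map fun r =>
    (Finset.univ.filter fun e : DEdge G => r.received e ≠ r.sent e).card).sum

/-- The protocol `σ` simulates `π` and tolerates the bit error rate `ρ`: whatever the inputs and
the adversary, if at most a fraction `ρ` of all the bits transmitted during the execution of `σ`
is flipped, then every party gives the output that she would give in the noiseless execution
of `π` on the same inputs. -/
def Tolerates [Fintype V] [DecidableRel G.Adj] (σ π : Protocol G X Y) (ρ : ℝ) : Prop :=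
  ∀ (x : ∀ p, X p) (A : Adversary G X),
    (σ.bitErrors A x : ℝ) ≤ ρ * ((σ.rounds : ℝ) * (Fintype.card (DEdge G) : ℝ)) →
      ∀ p, σ.result A x p = π.result (Adversary.noiseless G X) x p

end Protocol

end Protocols

/-! ## Tree codes and tree decoding -/

/-- A tree code of infinite depth with distance parameter `α`: the nodes of the infinite
`Γ`-ary tree are the words over `Γ`, and `label w` is the character on the arc into the nonempty
word `w`. Two equally long words `p a u` and `p b v` that part after the common prefix `p` are
required to be labelled differently on at least a fraction `α` of the arcs below `p`. -/
structure TreeCode (Γ : Type) (S : Type) [DecidableEq S] (α : ℝ) where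
  label : List Γ → S
  dist : ∀ (p : List Γ) (a b : Γ) (u v : List Γ), a ≠ b → u.length = v.length →
    α * ((u.length : ℝ) + 1) ≤
      (((Finset.range (u.length + 1)).filter fun i =>
        label (p ++ (a :: u).take (i + 1)) ≠ label (p ++ (b :: v).take (i + 1))).card : ℝ)

/-- Bit strings of length `9`, the representation of tree code characters on the channels. -/
abbrev Block : Type := Fin 9 → Bool

/-- The alphabet `{0, 1, bkp}`; `none` is the backup symbol. -/
abbrev CodeSym : Type := Option Bool

section RS

variable (𝒯 : TreeCode CodeSym (Fin 287) (1 / 2)) (enc : Fin 287 ↪ Block)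

/-- The Hamming distance, counted in characters, between the received word `r` and the codeword
of `y`. -/
def charDist (r : List Block) (y : List CodeSym) : ℕ :=
  ((Finset.range r.length).filter fun i =>
    r[i]? ≠ some (enc (𝒯.label (y.take (i + 1))))).card

theorem exists_treeDecode (r : List Block) :
    ∃ y : List CodeSym, y.length = r.length ∧
      ∀ z : List CodeSym, z.length = r.length → charDist 𝒯 enc r y ≤ charDist 𝒯 enc r z := by
  classical
  have h : ∃ n, ∃ y : List CodeSym, y.length = r.length ∧ charDist 𝒯 enc r y = n :=
    ⟨_, List.replicate r.length none, by simp, rfl⟩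
  obtain ⟨y, hy, hn⟩ := Nat.find_spec h
  refine ⟨y, hy, fun z hz => ?_⟩
  rw [hn]
  exact Nat.find_min' h ⟨z, hz, rfl⟩

/-- Tree decoding: a word whose codeword is nearest to the received word. -/
noncomputable def treeDecode (r : List Block) : List CodeSym :=
  Classical.choose (exists_treeDecode 𝒯 enc r)

/-- Parsing from left to right: each backup symbol deletes the symbol before it. -/
def parse {A : Type u} (y : List (Option A)) : List A :=
  y.foldl (fun acc s => match s with
    | some a => acc ++ [a]
    | none => acc.dropLast) []

/-- The length-`t` prefixes of a family of incoming transcripts, arranged round by round. -/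
def prefixRows {I : Type u} (t : ℕ) (z : I → List Bool) : List (I → Bool) :=
  (List.range t).map fun s i => (z i).getD s false

/-! In the following, `I` and `O` index the incoming and outgoing edges of one party, and
`f : List (I → Bool) → O → Bool` is her transmission function: what the protocol (on her input)
tells her to send, given the bits received in the previous rounds. -/

/-- A transmission function for `T` rounds, continued with zeros forever. -/
def padZero {I O : Type u} (T : ℕ) (f : List (I → Bool) → O → Bool) :
    List (I → Bool) → O → Bool :=
  fun h o => if h.length < T then f h o else false

/-- The transmission function, in the protocol with dummy edges, of a party of a `T`-round
protocol. To each incoming edge `i` belongs one outgoing dummy edge `inr i`, on which the bit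
received on `i` in the round before is passed on (a zero in the first round). The ordinary
edges `inl o` are used as before, with zeros in the additional round at the end. -/
def withDummies {I O : Type u} (T : ℕ) (f : List (I → Bool) → O → Bool) :
    List (I → Bool) → O ⊕ I → Bool
  | h, Sum.inl o => padZero T f h o
  | h, Sum.inr i => (h.getLastD fun _ => false) i

/-- The parsed transcript of a party, with outgoing part `w` and estimated incoming part `z`, is
consistent: every outgoing bit is the one that `f` specifies given the preceding incoming bits,
and the incoming transcripts reach far enough to determine the next outgoing bits. -/
def IsConsistent {I O : Type u} (f : List (I → Bool) → O → Bool)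
    (w : List (O → Bool)) (z : I → List Bool) : Prop :=
  (∀ i, w.length ≤ (z i).length) ∧
    ∀ t, t < w.length → w[t]? = some (f (prefixRows t z))

open Classical in
/-- The symbol sent next: the bits specified by `f` (one per outgoing edge) if the parsed
transcript is consistent, and otherwise the backup symbol (on all outgoing edges). -/
noncomputable def nextSymbol {I O : Type u} (f : List (I → Bool) → O → Bool)
    (w : List (O → Bool)) (z : I → List Bool) : Option (O → Bool) :=
  if IsConsistent f w z then some (f (prefixRows w.length z)) else none

/-- The symbols that a party sends in the first `τ` steps of the basic simulation of a protocol
in which she has the transmission function `f`, when `c s i` is the block that she receives on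
edge `i` in step `s` (steps are counted from `0`). In each step she decodes everything received
in the steps before, parses, and sends the next symbol. -/
noncomputable def sentSymbols {I O : Type u} (f : List (I → Bool) → O → Bool)
    (c : ℕ → I → Block) : ℕ → List (Option (O → Bool))
  | 0 => []
  | τ + 1 =>
    let y := sentSymbols f c τ
    y ++ [nextSymbol f (parse y) fun i =>
      parse (treeDecode 𝒯 enc ((List.range τ).map fun s => c s i))]

/-- The blocks of nine bits contained in a list of received bits. -/
def blocks {I : Type u} (h : List (I → Bool)) : ℕ → I → Block :=
  fun s i k => (h.getD (9 * s + k) fun _ => false) i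

variable {V : Type u} {G : Digraph V} {X : V → Type v} {Y : V → Type w}

/-- The symbols that party `p` with input `a` sends in the first `τ` steps of the simulation
of `π` when she receives the bits `h`. This is the basic simulation of the `(T + 1)`-round
protocol with dummy edges. -/
noncomputable def rsSymbols (π : Protocol G X Y) (p : V) (a : X p)
    (h : List (InNbr G p → Bool)) (τ : ℕ) : List (Option (OutNbr G p ⊕ InNbr G p → Bool)) :=
  sentSymbols 𝒯 enc (padZero (π.rounds + 1) (withDummies π.rounds (π.send p a))) (blocks h) τ

/-- The Rajagopalan–Schulman compiler, with the tree code `𝒯` and the representation `enc` of its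
characters by blocks of bits. From a `T`-round protocol `π` it makes a protocol on the same
digraph that runs for `2 T + 1` steps of `9` rounds each; one step serves to send one tree code
character on each edge. Nothing is sent on the dummy edges, but each party keeps track of what
she would have sent there; in the end she reads off her parsed outgoing transcript which bits
she would have received in `π`, and gives the output that `π` tells her to give. -/
noncomputable def rsCompiler (π : Protocol G X Y) : Protocol G X Y where
  rounds := 9 * (2 * π.rounds + 1)
  send p a h q :=
    let τ := h.length / 9
    let y : List CodeSym :=
      (rsSymbols 𝒯 enc π p a h (τ + 1)).map (Option.map fun b => b (Sum.inl q))
    enc (𝒯.label y) ⟨h.length % 9, Nat.mod_lt _ (by norm_num)⟩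
  output p a h :=
    let w := parse (rsSymbols 𝒯 enc π p a h (2 * π.rounds + 1))
    π.output p a (((w.drop 1).take π.rounds).map fun b i => b (Sum.inr i))

end RS

/-! ## Existence of the tree code -/

/-! Tree code. Words become digit sequences over the field with 283 elements, and a label is the
convolution of the sequence with fixed coefficients `c`. By linearity the distance condition says
that a difference word with nonzero oldest letter has nonzero convolutions at no fewer than half of
its times. The coefficients are chosen one at a time by the method of conditional expectations: a
vanishing convolution weighs 16, any other 1/16, and the total weight of the difference words never
has to grow (`exists_update_totalWeight_le`). As it stays at most 1, no single word has more zeros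
than nonzeros.

Simulation. Progress is the length of a correct prefix of a parsed transcript minus the length of
the rest. A step in which every party decodes correctly raises the guaranteed progress of all
parties by one (`hasProgress_nextSymbol_add_one`); any other step lowers it by at most one. A
decoding error needs a final stretch of received characters with error density at least 1/4, so a
covering argument (`card_bad_le`) bounds the bad steps by four times the number E of flipped bits.
After 2T+1 steps progress is at least 2T+1-8E, and the error bound makes this at least T+1. The
correct prefix then includes the dummy edges in rounds 2 to T+1, which hold all bits received in the
noiseless execution. -/

instance fact_prime_283 : Fact (Nat.Prime 283) := ⟨by norm_num⟩

/-- The pairing of a coefficient sequence with a word, read from its newest letter. -/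
def convDot {R : Type*} [CommRing R] (c : ℕ → R) : List R → R
  | [] => 0
  | a :: l => c 0 * a + convDot (fun n => c (n + 1)) l

/-- Linearity: the common older part `r` cancels, so only the difference after the branching point
matters. -/
theorem convDot_sub_append {R : Type*} [CommRing R] (l l' r : List R) (c : ℕ → R)
    (h : l.length = l'.length) :
    convDot c (l ++ r) - convDot c (l' ++ r) = convDot c (List.zipWith (· - ·) l l') := by
  induction l generalizing c l' with
  | nil =>
    obtain rfl : l' = [] := List.length_eq_zero_iff.mp h.symm
    simp [convDot]
  | cons a l ih =>
    cases l' with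
    | nil => simp at h
    | cons b l' =>
      simp only [List.length_cons, Nat.add_right_cancel_iff] at h
      simp only [List.cons_append, convDot, List.zipWith_cons_cons]
      rw [← ih l' _ h]
      ring

theorem convDot_congr {R : Type*} [CommRing R] (l : List R) (c c' : ℕ → R)
    (h : ∀ i < l.length, c i = c' i) : convDot c l = convDot c' l := by
  induction l generalizing c c' with
  | nil => rfl
  | cons a l ih =>
    simp only [convDot]
    rw [h 0 (by simp), ih _ (fun n => c' (n + 1)) fun i hi => h (i + 1) (by simpa using hi)]

/-- The coefficient with index `l.length` meets only the oldest letter `a`, so it enters affinely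
with slope `a`. -/
theorem convDot_update_concat {R : Type*} [CommRing R] (l : List R) (a x : R) (c : ℕ → R) :
    convDot (Function.update c l.length x) (l ++ [a]) = convDot c l + x * a := by
  induction l generalizing c with
  | nil => simp [convDot]
  | cons b l ih =>
    simp only [List.cons_append, convDot, List.length_cons]
    have h : (fun n => Function.update c (l.length + 1) x (n + 1)) =
        Function.update (fun n => c (n + 1)) l.length x := by
      funext n
      by_cases hn : n = l.length
      · subst hn; simp
      · rw [Function.update_of_ne (by omega), Function.update_of_ne hn]
    rw [h, ih, Function.update_of_ne (by omega)]
    ring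

/-- The weight of a word: a factor `16` for every suffix on which `convDot` vanishes and a factor
`1 / 16` for every other nonempty suffix. -/
def suffixWeight (c : ℕ → ZMod 283) : List (ZMod 283) → ℚ
  | [] => 1
  | a :: l => (if convDot c (a :: l) = 0 then 16 else 1 / 16) * suffixWeight c l

theorem suffixWeight_pos (c : ℕ → ZMod 283) (l : List (ZMod 283)) : 0 < suffixWeight c l := by
  induction l with
  | nil => simp [suffixWeight]
  | cons a l ih =>
    simp only [suffixWeight]
    split_ifs <;> positivity

theorem suffixWeight_congr (l : List (ZMod 283)) (c c' : ℕ → ZMod 283)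
    (h : ∀ i < l.length, c i = c' i) : suffixWeight c l = suffixWeight c' l := by
  induction l with
  | nil => rfl
  | cons a l ih =>
    simp only [suffixWeight]
    rw [convDot_congr _ c c' h, ih fun i hi => h i (by simp; omega)]

/-- The differences of digits. -/
def digitDiffs : Finset (ZMod 283) := {0, 1, -1, 2, -2}

/-- The words of length `n + 1` over the differences of digits whose oldest letter, which is the
last one, is not zero. -/
def diffWords : ℕ → Finset (List (ZMod 283))
  | 0 => (digitDiffs.erase 0).image fun d => [d]
  | n + 1 => (digitDiffs ×ˢ diffWords n).image fun q => q.1 :: q.2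

theorem mem_diffWords (n : ℕ) (l : List (ZMod 283)) (h : l ∈ diffWords n) :
    ∃ l' a, l = l' ++ [a] ∧ a ≠ 0 ∧ l'.length = n := by
  induction n generalizing l with
  | zero =>
    simp only [diffWords, Finset.mem_image, Finset.mem_erase] at h
    obtain ⟨d, ⟨h0, -⟩, rfl⟩ := h
    exact ⟨[], d, rfl, h0, rfl⟩
  | succ n ih =>
    simp only [diffWords, Finset.mem_image, Finset.mem_product] at h
    obtain ⟨⟨d, l₁⟩, ⟨-, h1⟩, rfl⟩ := h
    obtain ⟨l', a, rfl, ha, rfl⟩ := ih _ h1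
    exact ⟨d :: l', a, rfl, ha, rfl⟩

theorem length_of_mem_diffWords {n : ℕ} {l : List (ZMod 283)} (h : l ∈ diffWords n) :
    l.length = n + 1 := by
  obtain ⟨l', a, rfl, -, rfl⟩ := mem_diffWords n l h
  simp

/-- The total weight of all difference words of length `n + 1`. -/
def totalWeight (c : ℕ → ZMod 283) (n : ℕ) : ℚ :=
  ∑ l ∈ diffWords n, suffixWeight c l

theorem totalWeight_congr (n : ℕ) (c c' : ℕ → ZMod 283) (h : ∀ i ≤ n, c i = c' i) :
    totalWeight c n = totalWeight c' n :=
  Finset.sum_congr rfl fun l hl => suffixWeight_congr l c c' fun i hi =>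
    h i (by rw [length_of_mem_diffWords hl] at hi; omega)

theorem totalWeight_succ (c : ℕ → ZMod 283) (n : ℕ) :
    totalWeight c (n + 1) = ∑ d ∈ digitDiffs, ∑ l ∈ diffWords n, suffixWeight c (d :: l) := by
  rw [totalWeight, diffWords, Finset.sum_image, Finset.sum_product]
  rintro ⟨a, l⟩ - ⟨b, l'⟩ - h
  simpa using h

/-- As `a ≠ 0`, the convolution is an affine bijection of `x`: one value of `x` makes it vanish, the
other 282 do not. -/
theorem sum_factor_update (c : ℕ → ZMod 283) (l : List (ZMod 283)) (a : ZMod 283) (ha : a ≠ 0) :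
    ∑ x : ZMod 283,
      (if convDot (Function.update c l.length x) (l ++ [a]) = 0 then (16 : ℚ) else 1 / 16) =
      16 + 282 / 16 := by
  have h : ∀ x : ZMod 283, convDot (Function.update c l.length x) (l ++ [a]) = 0 ↔
      x = -convDot c l / a := by
    intro x
    rw [convDot_update_concat, eq_div_iff ha]
    constructor
    · intro h; linear_combination h
    · intro h; linear_combination h
  simp only [h]
  rw [Finset.sum_ite, Finset.filter_eq' Finset.univ, Finset.filter_ne' Finset.univ]
  simp [ZMod.card]
  norm_num

theorem exists_update_totalWeight_le (c : ℕ → ZMod 283) (n : ℕ) :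
    ∃ x, totalWeight (Function.update c (n + 1) x) (n + 1) ≤ totalWeight c n := by
  by_contra! hcon
  have h1 : ∑ _x : ZMod 283, totalWeight c n <
      ∑ x : ZMod 283, totalWeight (Function.update c (n + 1) x) (n + 1) :=
    Finset.sum_lt_sum_of_nonempty Finset.univ_nonempty fun x _ => hcon x
  have h2 : ∑ x : ZMod 283, totalWeight (Function.update c (n + 1) x) (n + 1) =
      ∑ d ∈ digitDiffs, ∑ l ∈ diffWords n, (16 + 282 / 16) * suffixWeight c l := by
    simp only [totalWeight_succ]
    rw [Finset.sum_comm]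
    refine Finset.sum_congr rfl fun d _ => ?_
    rw [Finset.sum_comm]
    refine Finset.sum_congr rfl fun l hl => ?_
    have hlen := length_of_mem_diffWords hl
    -- Words of length `n + 1` use only coefficients with index at most `n`, so only the factor of
    -- the full word depends on `x`.
    have h3 : ∀ x, suffixWeight (Function.update c (n + 1) x) l = suffixWeight c l := fun x =>
      suffixWeight_congr _ _ _ fun i hi => Function.update_of_ne (by omega) _ _
    simp only [suffixWeight, h3]
    rw [← Finset.sum_mul]
    congr 1
    obtain ⟨l', a, rfl, ha, rfl⟩ := mem_diffWords n l hl
    exact sum_factor_update c (d :: l') a ha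
  -- Averaging succeeds because 5 · (16 + 282/16) = 168.125 is below 283.
  have hcard : digitDiffs.card = 5 := by decide
  have hpos : 0 ≤ totalWeight c n := Finset.sum_nonneg fun l _ => (suffixWeight_pos c l).le
  rw [h2] at h1
  simp only [← Finset.mul_sum, Finset.sum_const, hcard, Finset.card_univ, ZMod.card,
    nsmul_eq_mul] at h1
  rw [← totalWeight] at h1
  push_cast at h1
  linarith

/-- The greedy choice of coefficients; stage `n` determines those with index at most `n`. -/
noncomputable def greedyStage : ℕ → ℕ → ZMod 283
  | 0 => fun _ => 1
  | n + 1 => Function.update (greedyStage n) (n + 1)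
      (Classical.choose (exists_update_totalWeight_le (greedyStage n) n))

theorem totalWeight_greedyStage (n : ℕ) : totalWeight (greedyStage n) n ≤ 1 := by
  induction n with
  | zero =>
    have h : ∀ d ∈ digitDiffs.erase 0, suffixWeight (fun _ => 1) [d] = 1 / 16 := by
      intro d hd
      simp [suffixWeight, convDot, (Finset.mem_erase.mp hd).1]
    have hcard : (digitDiffs.erase 0).card = 4 := by decide
    rw [totalWeight, diffWords, Finset.sum_image (by intro a _ b _ h; simpa using h), greedyStage,
      Finset.sum_congr rfl h, Finset.sum_const, hcard]
    norm_num
  | succ n ih =>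
    exact (Classical.choose_spec (exists_update_totalWeight_le (greedyStage n) n)).trans ih

theorem greedyStage_stable (i n : ℕ) (h : i ≤ n) : greedyStage n i = greedyStage i i := by
  induction n, h using Nat.le_induction with
  | base => rfl
  | succ n hn ih => rw [greedyStage, Function.update_of_ne (by omega), ih]

theorem exists_coefficients : ∃ c : ℕ → ZMod 283, ∀ n, totalWeight c n ≤ 1 := by
  refine ⟨fun i => greedyStage i i, fun n => ?_⟩
  rw [totalWeight_congr n _ (greedyStage n) fun i hi => (greedyStage_stable i n hi).symm]
  exact totalWeight_greedyStage n

/-! ### From weights to Hamming distance -/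

theorem suffixWeight_eq (c : ℕ → ZMod 283) (l : List (ZMod 283)) :
    suffixWeight c l.reverse = (16 : ℚ) ^ ((l.length : ℤ) - 2 *
      ((Finset.range l.length).filter fun i =>
        convDot c (l.take (i + 1)).reverse ≠ 0).card) := by
  induction l using List.reverseRecOn with
  | nil => simp [suffixWeight]
  | append_singleton l a ih =>
    have h1 : (Finset.range l.length).filter
          (fun i => convDot c ((l ++ [a]).take (i + 1)).reverse ≠ 0) =
        (Finset.range l.length).filter fun i => convDot c (l.take (i + 1)).reverse ≠ 0 := by
      refine Finset.filter_congr fun i hi => ?_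
      rw [List.take_append_of_le_length (by rw [Finset.mem_range] at hi; omega)]
    have h2 : (l ++ [a]).take (l.length + 1) = l ++ [a] := List.take_of_length_le (by simp)
    rw [List.length_append, List.length_singleton, Finset.range_add_one, Finset.filter_insert,
      h1, h2, List.reverse_append, List.reverse_singleton, List.singleton_append, suffixWeight, ih]
    split_ifs with h3 h4
    · exact absurd h3 h4
    · rw [← zpow_one_add₀ (by norm_num)]
      congr 1
      push_cast
      ring
    · rw [Finset.card_insert_of_notMem (by simp), one_div, ← zpow_neg_one,
        ← zpow_add₀ (by norm_num)]
      congr 1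
      push_cast
      ring

theorem reverse_mem_diffWords (d : ZMod 283) (l : List (ZMod 283)) (hd : d ∈ digitDiffs)
    (h0 : d ≠ 0) (hl : ∀ a ∈ l, a ∈ digitDiffs) : (d :: l).reverse ∈ diffWords l.length := by
  induction l using List.reverseRecOn with
  | nil => simp [diffWords, hd, h0]
  | append_singleton l a ih =>
    rw [← List.cons_append, List.reverse_append, List.length_append]
    simp only [List.reverse_singleton, List.singleton_append, List.length_singleton, diffWords,
      Finset.mem_image, Finset.mem_product]
    exact ⟨(a, (d :: l).reverse), ⟨hl a (by simp), ih fun b hb => hl b (by simp [hb])⟩, rfl⟩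

/-- Weights are positive, so a single one is at most the total, hence at most 1; its exponent to
base 16 is then not positive. -/
theorem le_two_mul_card_convDot_ne_zero (c : ℕ → ZMod 283) (hc : ∀ n, totalWeight c n ≤ 1)
    (d : ZMod 283) (l : List (ZMod 283)) (hd : d ∈ digitDiffs) (h0 : d ≠ 0)
    (hl : ∀ a ∈ l, a ∈ digitDiffs) :
    l.length + 1 ≤ 2 * ((Finset.range (l.length + 1)).filter fun i =>
      convDot c ((d :: l).take (i + 1)).reverse ≠ 0).card := by
  have h1 : suffixWeight c (d :: l).reverse ≤ 1 :=
    (Finset.single_le_sum (fun l _ => (suffixWeight_pos c l).le)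
      (reverse_mem_diffWords d l hd h0 hl)).trans (hc _)
  rw [suffixWeight_eq, zpow_le_one_iff_right₀ (by norm_num), List.length_cons] at h1
  omega

/-- The digits which represent the letters of the alphabet `{0, 1, bkp}`. -/
def symDigit : CodeSym → ZMod 283
  | none => 0
  | some false => 1
  | some true => 2

theorem symDigit_sub_mem (a b : CodeSym) : symDigit a - symDigit b ∈ digitDiffs := by
  revert a b; decide

theorem symDigit_injective : Function.Injective symDigit := by
  intro a b; revert a b; decide

theorem nonempty_treeCode : Nonempty (TreeCode CodeSym (Fin 287) (1 / 2)) := by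
  obtain ⟨c, hc⟩ := exists_coefficients
  obtain ⟨φ, hφ⟩ : ∃ φ : ZMod 283 → Fin 287, Function.Injective φ :=
    ⟨Fin.castLE (by norm_num), Fin.castLE_injective _⟩
  refine ⟨⟨fun w => φ (convDot c (w.map symDigit).reverse), ?_⟩⟩
  intro p a b u v hab huv
  have key := le_two_mul_card_convDot_ne_zero c hc (symDigit a - symDigit b)
    (List.zipWith (· - ·) (u.map symDigit) (v.map symDigit)) (symDigit_sub_mem a b)
    (sub_ne_zero.mpr (symDigit_injective.ne hab)) (by
      intro d hd
      rw [List.mem_iff_getElem] at hd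
      obtain ⟨i, hi, rfl⟩ := hd
      simp [symDigit_sub_mem])
  have hlen : (List.zipWith (· - ·) (u.map symDigit) (v.map symDigit)).length = u.length := by
    simp [huv]
  rw [hlen] at key
  have hset : ((Finset.range (u.length + 1)).filter fun i =>
      convDot c (((symDigit a - symDigit b) ::
        List.zipWith (· - ·) (u.map symDigit) (v.map symDigit)).take (i + 1)).reverse ≠ 0) ⊆
      (Finset.range (u.length + 1)).filter fun i =>
        φ (convDot c ((p ++ (a :: u).take (i + 1)).map symDigit).reverse) ≠
        φ (convDot c ((p ++ (b :: v).take (i + 1)).map symDigit).reverse) := by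
    refine Finset.monotone_filter_right _ fun i _ hi => ?_
    refine hφ.ne fun heq => hi ?_
    rw [List.map_append, List.map_append, List.reverse_append, List.reverse_append,
      ← sub_eq_zero, convDot_sub_append _ _ _ _ (by simp [huv])] at heq
    rw [← heq, ← List.reverse_zipWith (by simp [huv])]
    congr 2
    rw [← List.zipWith_cons_cons, ← List.map_cons, ← List.map_cons, List.take_zipWith,
      List.map_take, List.map_take]
  have h2 := Finset.card_le_card hset
  have h3 : ((u.length : ℝ) + 1) ≤ 2 * (((Finset.range (u.length + 1)).filter fun i =>
        φ (convDot c ((p ++ (a :: u).take (i + 1)).map symDigit).reverse) ≠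
        φ (convDot c ((p ++ (b :: v).take (i + 1)).map symDigit).reverse)).card : ℝ) := by
    exact_mod_cast key.trans (Nat.mul_le_mul_left 2 h2)
  linarith

/-! ## Parsed transcripts and progress -/

theorem parse_concat_some {A : Type u} (y : List (Option A)) (a : A) :
    parse (y ++ [some a]) = parse y ++ [a] := by
  simp only [parse, List.foldl_append, List.foldl_cons, List.foldl_nil]

theorem parse_concat_none {A : Type u} (y : List (Option A)) :
    parse (y ++ [none]) = (parse y).dropLast := by
  simp only [parse, List.foldl_append, List.foldl_cons, List.foldl_nil]

/-- Backups go out on all edges at once, so parsing a single edge yields that component of the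
sender's transcript. -/
theorem parse_map {A : Type u} {B : Type v} (f : A → B) (y : List (Option A)) :
    parse (y.map (Option.map f)) = (parse y).map f := by
  induction y using List.reverseRecOn with
  | nil => rfl
  | append_singleton y s ih =>
    rw [List.map_append, List.map_singleton]
    cases s with
    | none => rw [Option.map_none, parse_concat_none, parse_concat_none, ih, List.map_dropLast]
    | some a => rw [Option.map_some, parse_concat_some, parse_concat_some, ih]; simp

/-- The transcript `w` has a prefix that agrees with the sequence `W` and whose length exceeds
the length of the rest of `w` by at least `m`. -/
def HasProgress {A : Type u} (W : ℕ → A) (w : List A) (m : ℤ) : Prop :=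
  ∃ g : ℕ, (∀ t < g, w[t]? = some (W t)) ∧ g ≤ w.length ∧ m ≤ 2 * g - w.length

theorem HasProgress.concat {A : Type u} {W : ℕ → A} {w : List A} {m : ℤ}
    (h : HasProgress W w m) (a : A) : HasProgress W (w ++ [a]) (m - 1) := by
  obtain ⟨g, hg, hgw, hm⟩ := h
  refine ⟨g, fun t ht => ?_, by simp; omega, by simp; omega⟩
  rw [List.getElem?_append_left (by omega), hg t ht]

theorem HasProgress.concat_next {A : Type u} {W : ℕ → A} {w : List A} {g : ℕ} {m : ℤ}
    (hg : ∀ t < g, w[t]? = some (W t)) (hgw : g ≤ w.length) {a : A}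
    (hm : m ≤ 2 * g - w.length) (hnext : (w ++ [a])[g]? = some (W g)) :
    HasProgress W (w ++ [a]) (m + 1) := by
  refine ⟨g + 1, fun t ht => ?_, by simp; omega, by simp; omega⟩
  rcases Nat.lt_succ_iff_lt_or_eq.mp ht with ht | rfl
  · rw [List.getElem?_append_left (by omega), hg t ht]
  · exact hnext

theorem HasProgress.dropLast {A : Type u} {W : ℕ → A} {w : List A} {m : ℤ}
    (h : HasProgress W w m) : HasProgress W w.dropLast (m - 1) := by
  obtain ⟨g, hg, hgw, hm⟩ := h
  by_cases hlt : g < w.length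
  · refine ⟨g, fun t ht => ?_, by simp; omega, by simp; omega⟩
    rw [List.getElem?_dropLast, if_pos (by omega), hg t ht]
  · refine ⟨g - 1, fun t ht => ?_, by simp; omega, by simp; omega⟩
    rw [List.getElem?_dropLast, if_pos (by omega), hg t (by omega)]

theorem HasProgress.map {A : Type u} {B : Type v} (f : A → B) {W : ℕ → A} {w : List A} {m : ℤ}
    (h : HasProgress W w m) : HasProgress (fun t => f (W t)) (w.map f) m := by
  obtain ⟨g, hg, hgw, hm⟩ := h
  exact ⟨g, fun t ht => by simp [hg t ht], by simpa using hgw, by simpa using hm⟩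

theorem prefixRows_eq {I : Type u} {Z : ℕ → I → Bool} {z : I → List Bool} {n : ℕ}
    (h : ∀ i, ∀ t < n, (z i)[t]? = some (Z t i)) :
    prefixRows n z = (List.range n).map Z := by
  refine List.map_congr_left fun t ht => funext fun i => ?_
  simp [List.getD_eq_getElem?_getD, h i t (List.mem_range.mp ht)]

/-- The empty transcript is vacuously consistent, so a backup never meets an empty transcript and
the length always changes by exactly one. -/
theorem length_parse_nextSymbol {I O : Type u} (f : List (I → Bool) → O → Bool)
    (y : List (Option (O → Bool))) (z : I → List Bool) :
    (parse (y ++ [nextSymbol f (parse y) z])).length % 2 = ((parse y).length + 1) % 2 := by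
  rw [nextSymbol]
  split_ifs with h
  · rw [parse_concat_some]; simp
  · have h0 : (parse y).length ≠ 0 := fun h0 => h ⟨by simp [h0], by simp [h0]⟩
    rw [parse_concat_none, List.length_dropLast]
    omega

theorem hasProgress_nextSymbol_sub_one {I O : Type u} (f : List (I → Bool) → O → Bool)
    (y : List (Option (O → Bool))) (z : I → List Bool) {W : ℕ → O → Bool} {m : ℤ}
    (h : HasProgress W (parse y) m) :
    HasProgress W (parse (y ++ [nextSymbol f (parse y) z])) (m - 1) := by
  rcases nextSymbol f (parse y) z with _ | a
  · rw [parse_concat_none]; exact h.dropLast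
  · rw [parse_concat_some]; exact h.concat a

/-- If the parsed transcript of a party and the correctly decoded transcripts of her in-neighbours
have progress `m`, then the next step brings her progress to `m + 1`. -/
theorem hasProgress_nextSymbol_add_one {I O : Type u} (f : List (I → Bool) → O → Bool)
    (y : List (Option (O → Bool))) (z : I → List Bool) {W : ℕ → O → Bool} {Z : ℕ → I → Bool}
    (hWZ : ∀ t, W t = f ((List.range t).map Z)) {m : ℤ}
    (hpar : ((parse y).length : ℤ) % 2 = m % 2)
    (hz : ∀ i, HasProgress (fun t => Z t i) (z i) m) (h : HasProgress W (parse y) m) :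
    HasProgress W (parse (y ++ [nextSymbol f (parse y) z])) (m + 1) := by
  obtain ⟨g, hg, hgw, hm⟩ := h
  have hrow : ∀ t : ℕ, (∀ i (k : ℕ), k ≤ (z i).length → m ≤ 2 * k - (z i).length → t ≤ k) →
      prefixRows t z = (List.range t).map Z := by
    intro t ht
    refine prefixRows_eq fun i s hs => ?_
    obtain ⟨k, hk, hkz, hmk⟩ := hz i
    exact hk s (hs.trans_le (ht i k hkz hmk))
  set w := parse y with hw
  rw [nextSymbol]
  split_ifs with hc
  · rw [parse_concat_some, ← hw]
    -- By parity, progress beyond `m` is at least `m + 2`, and then a loss of one is harmless. The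
    -- remaining case is 2g - |w| = m.
    by_cases h2 : m + 2 ≤ 2 * g - w.length
    · have := HasProgress.concat (W := W) ⟨g, hg, hgw, h2⟩ (f (prefixRows w.length z))
      rwa [show m + 2 - 1 = m + 1 by ring] at this
    -- Consistency gives |z i| ≥ |w|, so the correct prefix of each `z i` reaches `g`. Hence the
    -- symbol at position `g`, old or new, is correct.
    · have hr := hrow g fun i k _ hk => by have := hc.1 i; omega
      refine HasProgress.concat_next hg hgw hm ?_
      rcases hgw.lt_or_eq with hlt | rfl
      · rw [List.getElem?_append_left hlt, hc.2 g hlt, hr, hWZ]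
      · rw [List.getElem?_append_right le_rfl, hr, hWZ]; simp
  · rw [parse_concat_none, ← hw]
    by_cases h2 : m + 2 ≤ 2 * g - w.length
    · have := HasProgress.dropLast (W := W) ⟨g, hg, hgw, h2⟩
      rwa [show m + 2 - 1 = m + 1 by ring] at this
    -- Either the backup removes a symbol outside the correct prefix, or all of `w` is correct and m
    -- = |w|; then the incoming transcripts are long and correct enough to make `w` consistent.
    · rcases hgw.lt_or_eq with hlt | rfl
      · refine ⟨g, fun t ht => ?_, by simp; omega, by simp; omega⟩
        rw [List.getElem?_dropLast, if_pos (by omega), hg t ht]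
      · refine absurd ⟨fun i => ?_, fun t ht => ?_⟩ hc
        · obtain ⟨k, -, hkz, hmk⟩ := hz i
          omega
        · rw [hg t ht, hWZ, hrow t fun i k _ _ => by omega]

/-! ## Errors of the tree decoder -/

theorem exists_split_of_ne {A : Type u} {x y : List A} (hl : x.length = y.length) (h : x ≠ y) :
    ∃ p a b s t, a ≠ b ∧ x = p ++ a :: s ∧ y = p ++ b :: t := by
  induction x generalizing y with
  | nil => exact absurd (List.length_eq_zero_iff.mp hl.symm).symm h
  | cons c x ih =>
    cases y with
    | nil => simp at hl
    | cons d y =>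
      by_cases hcd : c = d
      · subst hcd
        obtain ⟨p, a, b, s, t, hab, rfl, rfl⟩ := ih (by simpa using hl) fun h' => h (h' ▸ rfl)
        exact ⟨c :: p, a, b, s, t, hab, rfl, rfl⟩
      · exact ⟨[], c, d, x, y, hcd, rfl, rfl⟩

section Decoding

variable (𝒯 : TreeCode CodeSym (Fin 287) (1 / 2)) (enc : Fin 287 ↪ Block)

/-- The indicator of an error at position `i` when `y` is encoded and `r` received. -/
def charError (r : List Block) (y : List CodeSym) (i : ℕ) : ℕ :=
  if r[i]? ≠ some (enc (𝒯.label (y.take (i + 1)))) then 1 else 0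

theorem charDist_eq_sum (r : List Block) (y : List CodeSym) :
    charDist 𝒯 enc r y = ∑ i ∈ Finset.range r.length, charError 𝒯 enc r y i :=
  Finset.card_filter _ _

/-- A decoding error requires, for some `l`, at least `l / 4` errors among the last `l`
characters. -/
theorem exists_le_charError_of_treeDecode_ne (r : List Block) (y : List CodeSym)
    (hy : y.length = r.length) (h : treeDecode 𝒯 enc r ≠ y) :
    ∃ k l, 1 ≤ l ∧ k + l = r.length ∧
      l ≤ 4 * ∑ i ∈ Finset.range l, charError 𝒯 enc r y (k + i) := by
  obtain ⟨hlen, hmin⟩ := Classical.choose_spec (exists_treeDecode 𝒯 enc r)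
  have hle : charDist 𝒯 enc r (treeDecode 𝒯 enc r) ≤ charDist 𝒯 enc r y := hmin y hy
  have hd : (treeDecode 𝒯 enc r).length = r.length := hlen
  clear hlen hmin
  generalize treeDecode 𝒯 enc r = d at *
  obtain ⟨p, a, b, s, t, hab, rfl, rfl⟩ := exists_split_of_ne (hd.trans hy.symm) h
  have hst : s.length = t.length := by simp at hy hd; omega
  have hr : r.length = p.length + (s.length + 1) := by simp at hd; omega
  refine ⟨p.length, s.length + 1, by omega, hr.symm, ?_⟩
  have hdist := 𝒯.dist p a b s t hab hst
  rw [Finset.card_filter] at hdist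
  -- Where the two codewords differ, the received character disagrees with at least one of them.
  have htri : ∀ i ∈ Finset.range (s.length + 1),
      (if 𝒯.label (p ++ (a :: s).take (i + 1)) ≠ 𝒯.label (p ++ (b :: t).take (i + 1))
        then 1 else 0) ≤ charError 𝒯 enc r (p ++ a :: s) (p.length + i) +
          charError 𝒯 enc r (p ++ b :: t) (p.length + i) := by
    intro i _
    simp only [charError, add_assoc, List.take_length_add_append]
    by_cases h2 : r[p.length + i]? = some (enc (𝒯.label (p ++ (a :: s).take (i + 1))))
    · by_cases h3 : r[p.length + i]? = some (enc (𝒯.label (p ++ (b :: t).take (i + 1))))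
      · rw [if_neg (not_not.mpr (enc.injective (Option.some.inj (h2.symm.trans h3))))]
        exact Nat.zero_le _
      · rw [if_pos (c := r[p.length + i]? ≠ some (enc (𝒯.label (p ++ (b :: t).take (i + 1))))) h3]
        split_ifs <;> omega
    · rw [if_pos (c := r[p.length + i]? ≠ some (enc (𝒯.label (p ++ (a :: s).take (i + 1))))) h2]
      split_ifs <;> omega
  have htri := Finset.sum_le_sum htri
  rw [Finset.sum_add_distrib] at htri
  -- Errors before the split are the same for both words and cancel. Below it the decoded word has
  -- no more errors than `y`, so `y` accounts for at least half of the l/2 differences.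
  rw [charDist_eq_sum, charDist_eq_sum, hr, Finset.sum_range_add _ p.length,
    Finset.sum_range_add _ p.length, Finset.sum_congr rfl (g := fun i => charError 𝒯 enc r (p ++ b :: t) i)] at hle
  · have h4 : ((s.length + 1 : ℕ) : ℝ) ≤ 2 * ((∑ i ∈ Finset.range (s.length + 1),
        if 𝒯.label (p ++ (a :: s).take (i + 1)) ≠ 𝒯.label (p ++ (b :: t).take (i + 1))
          then 1 else 0 : ℕ) : ℝ) := by
      push_cast at hdist ⊢
      linarith
    have h5 : s.length + 1 ≤ 2 * ∑ i ∈ Finset.range (s.length + 1),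
        if 𝒯.label (p ++ (a :: s).take (i + 1)) ≠ 𝒯.label (p ++ (b :: t).take (i + 1))
          then 1 else 0 := by exact_mod_cast h4
    omega
  · intro i hi
    rw [Finset.mem_range] at hi
    simp only [charError]
    rw [List.take_append_of_le_length (by omega), List.take_append_of_le_length (by omega)]

end Decoding

open Classical in
/-- If every bad time `n` ends an interval on which the density of `e` is at least `1 / 4`, then
the number of bad times is at most four times the sum of `e`. -/
theorem card_bad_le (bad : ℕ → Prop) (e : ℕ → ℕ)
    (h : ∀ n, bad n → ∃ k l, 1 ≤ l ∧ k + l = n ∧ l ≤ 4 * ∑ i ∈ Finset.range l, e (k + i)) (n : ℕ) :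
    ((Finset.range (n + 1)).filter bad).card ≤ 4 * ∑ i ∈ Finset.range n, e i := by
  induction n using Nat.strong_induction_on with
  | _ n ih =>
  by_cases hn : bad n
  · obtain ⟨k, l, hl, rfl, hkl⟩ := h n hn
    have h1 := ih k (by omega)
    -- The dense interval pays for all `l` times from `k + 1` to `k + l`; the induction hypothesis
    -- handles those up to `k`.
    have h2 : ((Finset.range (k + l + 1)).filter bad) ⊆
        (Finset.range (k + 1)).filter bad ∪ Finset.Ico (k + 1) (k + l + 1) := by
      intro i hi
      simp only [Finset.mem_filter, Finset.mem_range, Finset.mem_union, Finset.mem_Ico] at hi ⊢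
      by_cases hik : i < k + 1
      · exact Or.inl ⟨hik, hi.2⟩
      · exact Or.inr (by omega)
    have h3 := (Finset.card_le_card h2).trans (Finset.card_union_le _ _)
    rw [Nat.card_Ico] at h3
    rw [Finset.sum_range_add]
    omega
  · rw [Finset.range_add_one, Finset.filter_insert, if_neg hn]
    cases n with
    | zero => simp
    | succ n =>
      have := ih n (by omega)
      rw [Finset.sum_range_succ]
      omega

/-! ## The basic simulation on a network -/

section Network

variable (𝒯 : TreeCode CodeSym (Fin 287) (1 / 2)) (enc : Fin 287 ↪ Block)

theorem length_sentSymbols {I O : Type u} (f : List (I → Bool) → O → Bool) (c : ℕ → I → Block)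
    (n : ℕ) : (sentSymbols 𝒯 enc f c n).length = n := by
  induction n with
  | zero => rfl
  | succ n ih => simp [sentSymbols, ih]

theorem take_sentSymbols {I O : Type u} (f : List (I → Bool) → O → Bool) (c : ℕ → I → Block)
    {k n : ℕ} (h : k ≤ n) : (sentSymbols 𝒯 enc f c n).take k = sentSymbols 𝒯 enc f c k := by
  induction n, h using Nat.le_induction with
  | base => exact List.take_of_length_le (length_sentSymbols 𝒯 enc f c k).le
  | succ n hn ih =>
    rw [sentSymbols, List.take_append_of_le_length (by rwa [length_sentSymbols]), ih]

/-- The last of the `n` symbols is sent before the block of its own step is used, so only blocks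
with `s + 1 < n` matter. -/
theorem sentSymbols_congr {I O : Type u} (f : List (I → Bool) → O → Bool) {c c' : ℕ → I → Block}
    (n : ℕ) (h : ∀ s, s + 1 < n → c s = c' s) :
    sentSymbols 𝒯 enc f c n = sentSymbols 𝒯 enc f c' n := by
  induction n with
  | zero => rfl
  | succ n ih =>
    have h1 : ∀ i, ((List.range n).map fun s => c s i) = (List.range n).map fun s => c' s i :=
      fun i => List.map_congr_left fun s hs => by
        rw [h s (by have := List.mem_range.mp hs; omega)]
    simp only [sentSymbols, ih fun s hs => h s (by omega), h1]

theorem length_parse_sentSymbols {I O : Type u} (f : List (I → Bool) → O → Bool)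
    (c : ℕ → I → Block) (n : ℕ) : (parse (sentSymbols 𝒯 enc f c n)).length % 2 = n % 2 := by
  induction n with
  | zero => rfl
  | succ n ih =>
    rw [sentSymbols, length_parse_nextSymbol]
    omega

variable {V : Type u} {G : Digraph V}

/-- The bits that party `p` receives in the first `t` rounds of the noiseless execution of the
protocol in which the parties have the transmission functions `F`, the edges of `G` being the
ordinary ones. -/
def noiselessRows (F : ∀ p, List (InNbr G p → Bool) → OutNbr G p ⊕ InNbr G p → Bool) :
    ℕ → ∀ p, List (InNbr G p → Bool)
  | 0, _ => []
  | t + 1, p => noiselessRows F t p ++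
      [fun q => F q.1 (noiselessRows F t q.1) (Sum.inl ⟨p, q.2⟩)]

theorem noiselessRows_eq (F : ∀ p, List (InNbr G p → Bool) → OutNbr G p ⊕ InNbr G p → Bool)
    (t : ℕ) (p : V) : noiselessRows F t p = (List.range t).map fun s (q : InNbr G p) =>
      F q.1 (noiselessRows F s q.1) (Sum.inl ⟨p, q.2⟩) := by
  induction t with
  | zero => rfl
  | succ t ih =>
    rw [noiselessRows, ih, List.range_succ, List.map_append]
    rfl

variable (F : ∀ p, List (InNbr G p → Bool) → OutNbr G p ⊕ InNbr G p → Bool)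
  (c : ∀ p, ℕ → InNbr G p → Block)

/-- The symbols that party `q` sends on the edge to `p` in the first `n` steps of the basic
simulation, if `c` are the blocks received. -/
noncomputable def edgeSymbols (p : V) (q : InNbr G p) (n : ℕ) : List CodeSym :=
  (sentSymbols 𝒯 enc (F q.1) (c q.1) n).map (Option.map fun b => b (Sum.inl ⟨p, q.2⟩))

/-- In step `n` some party decodes an incoming edge incorrectly. -/
def IsBadStep (n : ℕ) : Prop :=
  ∃ (p : V) (q : InNbr G p),
    treeDecode 𝒯 enc ((List.range n).map fun s => c p s q) ≠ edgeSymbols 𝒯 enc F c p q n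

open Classical in
/-- Every step without decoding errors brings all parties forward, and every other step sets them
back by at most one. -/
theorem hasProgress_sentSymbols (n : ℕ) (p : V) :
    HasProgress (fun t => F p (noiselessRows F t p)) (parse (sentSymbols 𝒯 enc (F p) (c p) n))
      (n - 2 * ((Finset.range n).filter (IsBadStep 𝒯 enc F c)).card) := by
  induction n generalizing p with
  | zero => exact ⟨0, by simp, by simp, by simp [sentSymbols, parse]⟩
  | succ n ih =>
    rw [Finset.range_add_one, Finset.filter_insert, sentSymbols]
    by_cases hbad : IsBadStep 𝒯 enc F c n
    · rw [if_pos hbad, Finset.card_insert_of_notMem (by simp)]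
      have h := hasProgress_nextSymbol_sub_one (F p) _ (fun i : InNbr G p => parse (treeDecode 𝒯 enc
        ((List.range n).map fun s => c p s i))) (ih p)
      convert h using 1
      push_cast
      ring
    · rw [if_neg hbad]
      have hdec : ∀ q : InNbr G p, parse (treeDecode 𝒯 enc ((List.range n).map fun s => c p s q)) =
          (parse (sentSymbols 𝒯 enc (F q.1) (c q.1) n)).map fun b => b (Sum.inl ⟨p, q.2⟩) := by
        intro q
        rw [← parse_map]
        congr 1
        by_contra hne
        exact hbad ⟨p, q, hne⟩
      have h := hasProgress_nextSymbol_add_one (F p) (sentSymbols 𝒯 enc (F p) (c p) n)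
        (fun i : InNbr G p => parse (treeDecode 𝒯 enc ((List.range n).map fun s => c p s i)))
        (W := fun t => F p (noiselessRows F t p))
        (Z := fun s (q : InNbr G p) => F q.1 (noiselessRows F s q.1) (Sum.inl ⟨p, q.2⟩))
        (fun t => by rw [noiselessRows_eq])
        -- The transcript length has the parity of `n`, which subtracting twice the number of bad
        -- steps preserves.
        (by have := length_parse_sentSymbols 𝒯 enc (F p) (c p) n; omega)
        (fun q => by rw [hdec]; exact (ih q.1).map fun b => b (Sum.inl ⟨p, q.2⟩)) (ih p)
      convert h using 1
      push_cast
      ring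

open Classical in
/-- If `e s` is positive whenever a block is received incorrectly in step `s`, then four times the
sum of `e` bounds the number of steps with decoding errors. -/
theorem card_isBadStep_le (e : ℕ → ℕ)
    (he : ∀ (s : ℕ) (p : V) (q : InNbr G p),
      c p s q ≠ enc (𝒯.label (edgeSymbols 𝒯 enc F c p q (s + 1))) → 1 ≤ e s) (n : ℕ) :
    ((Finset.range (n + 1)).filter (IsBadStep 𝒯 enc F c)).card ≤
      4 * ∑ i ∈ Finset.range n, e i := by
  refine card_bad_le _ e (fun n hbad => ?_) n
  obtain ⟨p, q, hne⟩ := hbad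
  obtain ⟨k, l, hl, hkl, hle⟩ := exists_le_charError_of_treeDecode_ne 𝒯 enc _ _
    (by simp [edgeSymbols, length_sentSymbols]) hne
  rw [List.length_map, List.length_range] at hkl
  refine ⟨k, l, hl, hkl, hle.trans (Nat.mul_le_mul_left 4 (Finset.sum_le_sum fun i hi => ?_))⟩
  have hi' : k + i < n := by rw [Finset.mem_range] at hi; omega
  rw [charError]
  split_ifs with h
  · refine he _ p q fun heq => h ?_
    rw [List.getElem?_map, List.getElem?_range hi', Option.map_some, heq]
    simp only [edgeSymbols]
    -- Sent symbols are never revised, so the prefix of the final word is the word encoded in step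
    -- `k + i`.
    rw [← List.map_take, take_sentSymbols 𝒯 enc _ _ hi']
  · exact Nat.zero_le _

end Network

/-! ## The compiler -/

section Compiler

variable {V : Type u} {G : Digraph V} {X : V → Type v} {Y : V → Type w}

/-- What happens on the channels in round `t` of an execution. -/
def Protocol.roundRecord (σ : Protocol G X Y) (A : Adversary G X) (x : ∀ p, X p) (t : ℕ) :
    RoundRecord G :=
  let s : DEdge G → Bool := fun e =>
    σ.send e.1.1 (x e.1.1) (receivedBy (σ.history A x t) e.1.1) ⟨e.1.2, e.2⟩
  ⟨s, A x (σ.history A x t) s⟩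

theorem Protocol.history_eq (σ : Protocol G X Y) (A : Adversary G X) (x : ∀ p, X p) (t : ℕ) :
    σ.history A x t = (List.range t).map (σ.roundRecord A x) := by
  induction t with
  | zero => rfl
  | succ t ih =>
    rw [List.range_succ, List.map_append, ← ih]
    rfl

theorem Protocol.bitErrors_eq [Fintype V] [DecidableRel G.Adj] (σ : Protocol G X Y)
    (A : Adversary G X) (x : ∀ p, X p) :
    σ.bitErrors A x = ∑ t ∈ Finset.range σ.rounds, (Finset.univ.filter fun e : DEdge G =>
      (σ.roundRecord A x t).received e ≠ (σ.roundRecord A x t).sent e).card := by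
  rw [Protocol.bitErrors, Protocol.history_eq, List.map_map]
  rfl

theorem sum_range_mul (f : ℕ → ℕ) (k n : ℕ) :
    ∑ t ∈ Finset.range (k * n), f t =
      ∑ s ∈ Finset.range n, ∑ i ∈ Finset.range k, f (k * s + i) := by
  induction n with
  | zero => simp
  | succ n ih => rw [Nat.mul_succ, Finset.sum_range_add, ih, Finset.sum_range_succ]

/-- The transmission function of party `p` in the protocol with dummy edges. -/
def dummyTransmission (π : Protocol G X Y) (x : ∀ p, X p) (p : V) :
    List (InNbr G p → Bool) → OutNbr G p ⊕ InNbr G p → Bool :=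
  padZero (π.rounds + 1) (withDummies π.rounds (π.send p (x p)))

theorem dummyTransmission_inl (π : Protocol G X Y) (x : ∀ p, X p) (p : V)
    (h : List (InNbr G p → Bool)) (hh : h.length < π.rounds) (o : OutNbr G p) :
    dummyTransmission π x p h (Sum.inl o) = π.send p (x p) h o := by
  simp [dummyTransmission, padZero, withDummies, hh, hh.trans (Nat.lt_succ_self _)]

theorem dummyTransmission_inr (π : Protocol G X Y) (x : ∀ p, X p) (p : V)
    (h : List (InNbr G p → Bool)) (hh : h.length ≤ π.rounds) (i : InNbr G p) :
    dummyTransmission π x p h (Sum.inr i) = h.getLastD (fun _ => false) i := by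
  simp [dummyTransmission, padZero, withDummies, Nat.lt_succ_of_le hh]

theorem length_noiselessRows (F : ∀ p, List (InNbr G p → Bool) → OutNbr G p ⊕ InNbr G p → Bool)
    (t : ℕ) (p : V) : (noiselessRows F t p).length = t := by
  rw [noiselessRows_eq, List.length_map, List.length_range]

theorem noiselessRows_dummyTransmission (π : Protocol G X Y) (x : ∀ p, X p) (t : ℕ)
    (ht : t ≤ π.rounds) (p : V) :
    noiselessRows (dummyTransmission π x) t p =
      receivedBy (π.history (Adversary.noiseless G X) x t) p := by
  induction t generalizing p with
  | zero => rfl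
  | succ t ih =>
    have h1 : ∀ (q : V) (o : OutNbr G q), dummyTransmission π x q
        (noiselessRows (dummyTransmission π x) t q) (Sum.inl o) =
        π.send q (x q) (receivedBy (π.history (Adversary.noiseless G X) x t) q) o := by
      intro q o
      rw [dummyTransmission_inl π x q _ (by rw [length_noiselessRows]; omega), ih (by omega)]
    rw [noiselessRows, ih (by omega), Protocol.history, receivedBy, receivedBy, List.map_append]
    simp only [h1]
    rfl

/-- The dummy edges carry the bits received in the noiseless execution. -/
theorem map_inr_of_agree (π : Protocol G X Y) (x : ∀ p, X p) (p : V)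
    (w : List (OutNbr G p ⊕ InNbr G p → Bool))
    (hw : ∀ t < π.rounds + 1, w[t]? =
      some (dummyTransmission π x p (noiselessRows (dummyTransmission π x) t p))) :
    (((w.drop 1).take π.rounds).map fun b i => b (Sum.inr i)) =
      noiselessRows (dummyTransmission π x) π.rounds p := by
  refine List.ext_getElem? fun t => ?_
  rw [noiselessRows_eq]
  by_cases ht : t < π.rounds
  · rw [List.getElem?_map, List.getElem?_take_of_lt ht, List.getElem?_drop,
      hw (1 + t) (by omega), List.getElem?_map, List.getElem?_range ht, Option.map_some,
      Option.map_some]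
    congr 1
    funext i
    -- Entry `t + 1` of the transcript forwards the bit received in round `t`; this shift is why the
    -- first entry is dropped.
    rw [dummyTransmission_inr π x p _ (by rw [length_noiselessRows]; omega), add_comm 1 t,
      noiselessRows, List.getLastD_concat]
  · rw [List.getElem?_eq_none (by simp; omega), List.getElem?_eq_none (by simpa using ht)]

/-! ### Grouping the channel rounds into steps of nine -/

variable (𝒯 : TreeCode CodeSym (Fin 287) (1 / 2)) (enc : Fin 287 ↪ Block)

/-- The blocks that party `p` receives in an execution of the compiled protocol. -/
noncomputable def channelBlocks (π : Protocol G X Y) (A : Adversary G X) (x : ∀ p, X p) (p : V) :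
    ℕ → InNbr G p → Block :=
  fun s i k => ((rsCompiler 𝒯 enc π).roundRecord A x (9 * s + k)).received ⟨(i.1, p), i.2⟩

/-- The first `n` symbols depend on `n - 1` complete blocks, hence on 9(n - 1) rounds. -/
theorem rsSymbols_receivedBy_history (π : Protocol G X Y) (A : Adversary G X) (x : ∀ p, X p)
    (p : V) (r n : ℕ) (h : 9 * n ≤ r + 9) :
    rsSymbols 𝒯 enc π p (x p) (receivedBy ((rsCompiler 𝒯 enc π).history A x r) p) n =
      sentSymbols 𝒯 enc (dummyTransmission π x p) (channelBlocks 𝒯 enc π A x p) n := by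
  refine sentSymbols_congr 𝒯 enc _ n fun s hs => funext fun i => funext fun k => ?_
  rw [blocks, channelBlocks, Protocol.history_eq, receivedBy, List.map_map,
    List.getD_eq_getElem?_getD, List.getElem?_map, List.getElem?_range (by omega)]
  rfl

theorem rsCompiler_send (π : Protocol G X Y) (p : V) (a : X p) (h : List (InNbr G p → Bool))
    (q : OutNbr G p) (s : ℕ) (k : Fin 9) (hh : h.length = 9 * s + k) :
    (rsCompiler 𝒯 enc π).send p a h q = enc (𝒯.label
      ((rsSymbols 𝒯 enc π p a h (s + 1)).map (Option.map fun b => b (Sum.inl q)))) k := by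
  have hdiv : h.length / 9 = s := by omega
  have hmod : (⟨h.length % 9, Nat.mod_lt _ (by norm_num)⟩ : Fin 9) = k := Fin.ext (by simp; omega)
  simp only [rsCompiler, hdiv, hmod]

theorem roundRecord_sent (π : Protocol G X Y) (A : Adversary G X) (x : ∀ p, X p) (p : V)
    (q : InNbr G p) (s : ℕ) (k : Fin 9) :
    ((rsCompiler 𝒯 enc π).roundRecord A x (9 * s + k)).sent ⟨(q.1, p), q.2⟩ =
      enc (𝒯.label (edgeSymbols 𝒯 enc (dummyTransmission π x) (channelBlocks 𝒯 enc π A x) p q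
        (s + 1))) k := by
  have hlen : (receivedBy ((rsCompiler 𝒯 enc π).history A x (9 * s + k)) q.1).length =
      9 * s + k := by simp [receivedBy, Protocol.history_eq]
  have hs := rsSymbols_receivedBy_history 𝒯 enc π A x q.1 (9 * s + k) (s + 1) (by omega)
  rw [edgeSymbols, ← hs]
  exact rsCompiler_send 𝒯 enc π q.1 (x q.1) _ _ s k hlen

-- A wrong block contains a flipped bit, so the flips in the nine rounds of a step, over all edges,
-- serve as its error weight. The characters of the last step are never decoded, and its flips are
-- discarded from the bound.
open Classical in
theorem card_isBadStep_le_bitErrors [Fintype V] [DecidableRel G.Adj] (π : Protocol G X Y)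
    (A : Adversary G X) (x : ∀ p, X p) :
    ((Finset.range (2 * π.rounds + 1)).filter (IsBadStep 𝒯 enc (dummyTransmission π x)
      (channelBlocks 𝒯 enc π A x))).card ≤ 4 * (rsCompiler 𝒯 enc π).bitErrors A x := by
  rw [Protocol.bitErrors_eq, show (rsCompiler 𝒯 enc π).rounds = 9 * (2 * π.rounds + 1) from rfl,
    sum_range_mul, Finset.sum_range_succ]
  refine le_trans ?_ (Nat.mul_le_mul_left 4 (Nat.le_add_right _ _))
  refine card_isBadStep_le 𝒯 enc (dummyTransmission π x) (channelBlocks 𝒯 enc π A x) _ ?_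
    (2 * π.rounds)
  intro s p q hne
  obtain ⟨k, hk⟩ := Function.ne_iff.mp hne
  rw [← roundRecord_sent] at hk
  refine le_trans ?_ (Finset.single_le_sum (fun _ _ => Nat.zero_le _)
    (Finset.mem_range.mpr k.isLt))
  exact Finset.card_pos.mpr ⟨⟨(q.1, p), q.2⟩, Finset.mem_filter.mpr ⟨Finset.mem_univ _, hk⟩⟩

theorem tolerates_rsCompiler [Fintype V] [DecidableRel G.Adj] (π : Protocol G X Y) :
    (rsCompiler 𝒯 enc π).Tolerates π (1 / (1296 * (Fintype.card (DEdge G) : ℝ))) := by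
  classical
  intro x A hE p
  -- Since 1296 = 9 · 144, the block length and the number of edges cancel from the error budget.
  have hE' : 144 * (rsCompiler 𝒯 enc π).bitErrors A x ≤ 2 * π.rounds + 1 := by
    rw [show (rsCompiler 𝒯 enc π).rounds = 9 * (2 * π.rounds + 1) from rfl] at hE
    have h : (144 : ℝ) * (rsCompiler 𝒯 enc π).bitErrors A x ≤ 2 * π.rounds + 1 := by
      -- Without edges the total number of transmitted bits is zero, so the hypothesis still forces
      -- zero errors.
      rcases Nat.eq_zero_or_pos (Fintype.card (DEdge G)) with h0 | h0
      · rw [h0] at hE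
        simp only [Nat.cast_zero, mul_zero] at hE
        have : (0 : ℝ) ≤ π.rounds := Nat.cast_nonneg _
        linarith
      · have h1 : (0 : ℝ) < Fintype.card (DEdge G) := Nat.cast_pos.mpr h0
        rw [div_mul_eq_mul_div, le_div_iff₀ (by positivity)] at hE
        push_cast at hE
        refine le_of_mul_le_mul_right ?_ h1
        linarith
    exact_mod_cast h
  have hbad := card_isBadStep_le_bitErrors 𝒯 enc π A x
  obtain ⟨g, hg, hgw, hm⟩ := hasProgress_sentSymbols 𝒯 enc (dummyTransmission π x)
    (channelBlocks 𝒯 enc π A x) (2 * π.rounds + 1) p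
  -- From g ≤ |w| follows g ≥ 2g - |w| ≥ 2T + 1 - 8E, and 144E ≤ 2T + 1 leaves ample room, also for
  -- T = 0, where E = 0.
  have hgT : π.rounds + 1 ≤ g := by
    push_cast at hm
    omega
  rw [Protocol.result, Protocol.result, ← noiselessRows_dummyTransmission π x _ le_rfl,
    ← map_inr_of_agree π x p _ fun t ht => hg t (by omega),
    ← rsSymbols_receivedBy_history 𝒯 enc π A x p (9 * (2 * π.rounds + 1)) _ (by omega)]
  rfl

end Compiler

theorem mainTheorem8 :
    Nonempty (TreeCode CodeSym (Fin 287) (1 / 2)) ∧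
    ∀ (𝒯 : TreeCode CodeSym (Fin 287) (1 / 2)) (enc : Fin 287 ↪ Block)
      (V : Type u) [Fintype V] (G : Digraph V) [DecidableRel G.Adj]
      (X : V → Type v) (Y : V → Type w) (π : Protocol G X Y),
      (1 ≤ π.rounds → (rsCompiler 𝒯 enc π).rounds ≤ 27 * π.rounds) ∧
      (rsCompiler 𝒯 enc π).Tolerates π
        (1 / (1296 * (Fintype.card (DEdge G) : ℝ))) := by
  refine ⟨nonempty_treeCode, fun 𝒯 enc V _ G _ X Y π => ⟨fun h => ?_, tolerates_rsCompiler 𝒯 enc π⟩⟩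
  change 9 * (2 * π.rounds + 1) ≤ 27 * π.rounds
  omega
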